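/- Let $L\ge 0$ and $M\ge 1$ be integers and let $\Omega=\{0,\tfrac{2\pi}{M},\dots,\tfrac{2\pi(M-1)}{M}\}$ be the set of $M$-PSK phases. Let $f_\upsilon$ be a probability density on $(-\pi,\pi]$, extended $2\pi$-periodically to $\mathbb R$ (phases are taken modulo $2\pi$); for example the Tikhonov density $f_\upsilon(x)=e^{\beta\cos x}/(2\pi I_0(\beta))$, $\beta\ge 0$. Let $\mathcal K_B=(\kappa_0,\dots,\kappa_{L-1})$ be a key whose symbols are i.i.d. uniform on $\{0,\dots,M-1\}$, with phases $\varphi_k=2\pi\kappa_k/M\in\Omega$; let the artificial phase noises $\upsilon_0,\dots,\upsilon_{L-1}\in(-\pi,\pi]$ be i.i.d. with density $f_\upsilon$; and let the common phase rotation $\lambda$ be uniform on $(-\pi,\pi]$; the key, the noises and $\lambda$ are independent. Bob answers Alice's challenge on subcarrier $k$ with the complex amplitude $e^{j(\varphi_k-\hat\theta_k+\upsilon_k)}$, where $\hat\theta_k$ is his estimate of the channel phase. In the worst case all channels are static, so that $\hat\theta_k\in\mathbb R$ and Eve's subchannel gains $\tilde h_k\in\mathbb C$ are fixed (non-random) numbers,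 and Eve observes without noise $Z=(z_0,\dots,z_{L-1})$, $$z_k=\tilde h_k\,e^{j\lambda}\,e^{j(\varphi_k-\hat\theta_k+\upsilon_k)},\qquad k=0,\dots,L-1$$ (after compensation of the known phases, $z_k=|\tilde h_k|e^{j(\varphi_k+\upsilon_k+\lambda)}$, which is the case $\hat\theta_k=\arg\tilde h_k$). Let $H(\mathcal K_B\mid Z)$ be the conditional Shannon entropy, in bits, of the key given $Z$. Then, with $\varphi$ uniform on $\Omega$ and $\upsilon$ independent of $\varphi$ with density $f_\upsilon$, the random variable in brackets below is integrable and $$H(\mathcal K_B\mid Z)\;\ge\; L\cdot E_{\varphi,\upsilon}\left[\log_2\frac{\sum_{\bar\varphi\in\Omega}f_\upsilon(\varphi+\upsilon-\bar\varphi)}{f_\upsilon(\upsilon)}\right].$$ -/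

import Mathlib

open MeasureTheory ProbabilityTheory

noncomputable section

namespace PhaseAuth

/-- Conditional Shannon entropy `H(K | Z)`, in bits, of a random variable `K` with values in a
finite set given an arbitrary random variable `Z`: the expectation over `Z` of the entropy
`∑ k, -P(K = k | Z) log₂ P(K = k | Z)` of the posterior law of `K`. -/
def equivocation {S 𝒦 𝒵 : Type*} [MeasurableSpace S] [MeasurableSpace 𝒵]
    [Fintype 𝒦] [Nonempty 𝒦] [MeasurableSpace 𝒦] [StandardBorelSpace 𝒦]
    (K : S → 𝒦) (Z : S → 𝒵) (μ : Measure S) [IsFiniteMeasure μ] : ℝ :=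
  ∫ z, (∑ k : 𝒦, Real.negMulLog ((condDistrib K Z μ z).real {k})) / Real.log 2 ∂(μ.map Z)

/-- The point `2πκ/M` of the `M`-ary PSK phase set `Ω = {0, 2π/M, …, 2π(M-1)/M}`. -/
def pskPhase {M : ℕ} (κ : Fin M) : ℝ := 2 * Real.pi * (κ : ℕ) / M

/-- A probability density of a phase: a density on `(-π, π]`, extended `2π`-periodically to `ℝ`
so that it can be evaluated at sums and differences of phases, which are taken modulo `2π`. -/
structure IsPhaseDensity (f : ℝ → ℝ) : Prop where
  measurable : Measurable f
  nonneg : ∀ x, 0 ≤ f x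
  periodic : Function.Periodic f (2 * Real.pi)
  integral_eq_one : ∫ x in Set.Ioc (-Real.pi) Real.pi, f x = 1

/-- The law on `(-π, π]` with density `f`. -/
def phaseLaw (f : ℝ → ℝ) : Measure ℝ :=
  (volume.restrict (Set.Ioc (-Real.pi) Real.pi)).withDensity fun x => ENNReal.ofReal (f x)

/-- The uniform law on `(-π, π]`. -/
def uniformPhaseLaw : Measure ℝ := cond volume (Set.Ioc (-Real.pi) Real.pi)

/-- The uniform law on the `M` key symbols. -/
def uniformSymbolLaw (M : ℕ) [NeZero M] : Measure (Fin M) :=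
  (PMF.uniformOfFintype (Fin M)).toMeasure

/-- Bob's response on one subcarrier: the complex amplitude `exp(j(φ - θ̂ + υ))`, where `φ` is the
phase of the key symbol `κ`, `θ̂` is Bob's estimate of the channel phase and `υ` is the artificial
phase noise. -/
def bobResponse {M : ℕ} (thetaHat : ℝ) (κ : Fin M) (υ : ℝ) : ℂ :=
  Complex.exp (Complex.I * ((pskPhase κ - thetaHat + υ : ℝ) : ℂ))

/-- Eve's noise-free observation of Bob's response on `L` subcarriers, through subchannel gains
`h k` and with a common phase rotation `lam`: `z_k = h_k exp(j lam) exp(j(φ_k - θ̂_k + υ_k))`. -/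
def eveObservation {L M : ℕ} (h : Fin L → ℂ) (thetaHat : Fin L → ℝ)
    (κ : Fin L → Fin M) (υ : Fin L → ℝ) (lam : ℝ) : Fin L → ℂ :=
  fun k => h k * Complex.exp (Complex.I * (lam : ℂ)) * bobResponse (thetaHat k) (κ k) (υ k)

/-- The quantity `log₂ (∑_{φ' ∈ Ω} f (φ + υ - φ') / f υ)`, where `φ` is the phase of `p.1` and
`υ = p.2`. -/
def logRatio (f : ℝ → ℝ) {M : ℕ} (p : Fin M × ℝ) : ℝ :=
  Real.logb 2 ((∑ κ' : Fin M, f (pskPhase p.1 + p.2 - pskPhase κ')) / f p.2)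

end PhaseAuth

end

/-! Let `q` be the posterior law of the key given `Z`. Since `log t ≤ t - 1`, any positive `R` with
`E[q(K | Z) R] ≤ 1` satisfies `E[log R] ≤ H(K | Z)` in nats, given the integrability
(`integral_log_le_condEntropy`). Take for `R` the product over subcarriers of `posteriorInv`, the
inverse posterior of the symbols given the rotated phases `φ_k + υ_k`. By linearity, `E[log R]` is
`L` times the single-subcarrier expectation.

For the condition on `R`, fix the value of `lam`: then `Z` is a function of the phases `x = φ + υ`
modulo `2π`. Multiplying the noise density by `R` gives at most the product of the `phaseMixture`
values at `x`, which no longer involves the key except through `x`. Rotating the circle makes `x`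
the integration variable for every key; the posterior then sums over keys to at most `1`, and the
mixtures integrate to `M ^ L`, cancelling the key probability `M⁻¹ ^ L`
(`IsPhaseDensity.lintegral_mul_posteriorInv_le_one`). No density for `Z` is needed, and the gains
may vanish. -/

open scoped ENNReal

/-! ### Product densities and rotations of the circle. -/

/-- Tonelli for a product of functions of the individual coordinates. -/
theorem lintegral_pi_fin_prod {E : Type*} [MeasurableSpace E] {n : ℕ} (μ : Fin n → Measure E)
    [∀ i, SigmaFinite (μ i)] (f : Fin n → E → ℝ≥0∞) (hf : ∀ i, Measurable (f i)) :
    ∫⁻ x, ∏ i, f i (x i) ∂Measure.pi μ = ∏ i, ∫⁻ y, f i y ∂μ i := by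
  induction n with
  | zero => simp
  | succ n ih =>
    have hm : Measurable fun y : Fin n → E => ∏ i, f (Fin.succ i) (y i) :=
      Finset.measurable_fun_prod _ fun i _ => (hf _).comp (measurable_pi_apply i)
    rw [← (measurePreserving_piFinSuccAbove μ 0).symm.lintegral_comp_emb
      (MeasurableEquiv.measurableEmbedding _), Fin.prod_univ_succ,
      ← ih (fun i => μ i.succ) (fun i => f i.succ) (fun i => hf _),
      ← lintegral_prod_mul (hf 0).aemeasurable hm.aemeasurable]
    simp [MeasurableEquiv.piFinSuccAbove, Fin.prod_univ_succ]

/-- A finite product of measures with densities has the product density. -/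
theorem pi_withDensity {E : Type*} [MeasurableSpace E] {n : ℕ} (μ : Fin n → Measure E)
    [∀ i, SigmaFinite (μ i)] (f : Fin n → E → ℝ≥0∞) (hf : ∀ i, Measurable (f i))
    [∀ i, SigmaFinite ((μ i).withDensity (f i))] :
    Measure.pi (fun i => (μ i).withDensity (f i))
      = (Measure.pi μ).withDensity fun x => ∏ i, f i (x i) := by
  classical
  refine Measure.pi_eq fun s hs => ?_
  rw [withDensity_apply _ (MeasurableSet.univ_pi hs), ← lintegral_indicator (.univ_pi hs)]
  have h : ∀ x : Fin n → E, (Set.univ.pi s).indicator (fun x => ∏ i, f i (x i)) x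
      = ∏ i, (s i).indicator (f i) (x i) := by
    intro x
    by_cases hx : x ∈ Set.univ.pi s
    · rw [Set.indicator_of_mem hx]
      exact Finset.prod_congr rfl fun i _ => (Set.indicator_of_mem (hx i trivial) _).symm
    · rw [Set.indicator_of_notMem hx]
      simp only [Set.mem_pi, Set.mem_univ, true_imp_iff, not_forall] at hx
      obtain ⟨i, hi⟩ := hx
      exact (Finset.prod_eq_zero (Finset.mem_univ i) (Set.indicator_of_notMem hi _)).symm
  simp_rw [h]
  rw [lintegral_pi_fin_prod μ _ fun i => (hf i).indicator (hs i)]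
  exact Finset.prod_congr rfl fun i _ => by
    rw [lintegral_indicator (hs i), withDensity_apply _ (hs i)]

/-- The integral of a periodic function over a period is invariant under translation. -/
theorem Function.Periodic.setLIntegral_Ioc_add {T : ℝ} (hT : 0 < T) {g : ℝ → ℝ≥0∞}
    (hg : Function.Periodic g T) (t a : ℝ) :
    ∫⁻ x in Set.Ioc t (t + T), g (a + x) = ∫⁻ x in Set.Ioc t (t + T), g x := by
  have h1 : ∫⁻ x in Set.Ioc t (t + T), g (a + x) = ∫⁻ x in Set.Ioc (a + t) (a + t + T), g x := by
    rw [← lintegral_indicator measurableSet_Ioc, ← lintegral_indicator measurableSet_Ioc,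
      ← lintegral_add_left_eq_self (Set.indicator (Set.Ioc (a + t) (a + t + T)) g) a]
    refine lintegral_congr fun x => ?_
    simp only [Set.indicator, Set.mem_Ioc, add_assoc, add_lt_add_iff_left, add_le_add_iff_left]
  rw [h1]
  -- Both intervals are fundamental domains for the translations by multiples of `T`.
  refine (isAddFundamentalDomain_Ioc hT (a + t)).setLIntegral_eq (isAddFundamentalDomain_Ioc hT t)
    g ?_
  rintro ⟨_, n, rfl⟩ x
  rw [AddSubgroup.vadd_def, vadd_eq_add, add_comm]
  exact hg.zsmul n x

theorem measurable_toIocMod {T : ℝ} (hT : 0 < T) (t : ℝ) : Measurable (toIocMod hT t) := by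
  have : toIocMod hT t = fun b => b - (-⌊(t + T - b) / T⌋ : ℤ) • T := by
    funext b
    rw [toIocMod, toIocDiv_eq_neg_floor]
  rw [this]
  simp only [zsmul_eq_mul]
  fun_prop

/-- Rotations preserve Lebesgue measure on a period. -/
theorem measurePreserving_toIocMod_add {T : ℝ} (hT : 0 < T) (t a : ℝ) :
    MeasurePreserving (fun x => toIocMod hT t (a + x)) (volume.restrict (Set.Ioc t (t + T)))
      (volume.restrict (Set.Ioc t (t + T))) := by
  have hm : Measurable fun x => toIocMod hT t (a + x) :=
    (measurable_toIocMod hT t).comp (measurable_const_add a)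
  refine ⟨hm, Measure.ext_of_lintegral _ fun g hg => ?_⟩
  rw [lintegral_map hg hm]
  have hper : Function.Periodic (fun x => g (toIocMod hT t x)) T := fun x => by
    simp
  rw [hper.setLIntegral_Ioc_add hT t a]
  refine setLIntegral_congr_fun measurableSet_Ioc fun x hx => ?_
  rw [(toIocMod_eq_self hT).2 hx]

/-- Rotating the coordinates does not change the integral over a box of a function that is periodic
in each coordinate. -/
theorem lintegral_pi_Ioc_add {n : ℕ} {T : ℝ} (hT : 0 < T) (t : ℝ) (a : Fin n → ℝ)
    {g : (Fin n → ℝ) → ℝ≥0∞} (hg : Measurable g)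
    (hper : ∀ x, g (fun i => toIocMod hT t (x i)) = g x) :
    ∫⁻ x, g (fun i => a i + x i) ∂Measure.pi (fun _ => volume.restrict (Set.Ioc t (t + T)))
      = ∫⁻ x, g x ∂Measure.pi (fun _ => volume.restrict (Set.Ioc t (t + T))) := by
  have h := measurePreserving_pi (fun _ : Fin n => volume.restrict (Set.Ioc t (t + T))) _
    fun i => measurePreserving_toIocMod_add hT t (a i)
  rw [← h.lintegral_comp hg]
  exact lintegral_congr fun x => (hper _).symm

/-! ### Gibbs' inequality for conditional entropy. -/

section Gibbs

variable {S 𝒦 𝒵 : Type*} [MeasurableSpace S] [MeasurableSpace 𝒵]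
  [Fintype 𝒦] [Nonempty 𝒦] [MeasurableSpace 𝒦] [StandardBorelSpace 𝒦]
  {K : S → 𝒦} {Z : S → 𝒵} {μ : Measure S} [IsProbabilityMeasure μ]

theorem measurable_condDistrib_real_singleton :
    Measurable fun p : 𝒵 × 𝒦 => (condDistrib K Z μ p.1).real {p.2} :=
  measurable_from_prod_countable_left fun k =>
    ((condDistrib K Z μ).measurable_coe (measurableSet_singleton k)).ennreal_toReal

/-- For fixed `z` the integral of `|log q|` is a sum of terms `-q log q ≤ 1 - q ≤ 1`, hence bounded
by the number of keys. -/
theorem integrable_log_condDistrib :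
    Integrable (fun p : 𝒵 × 𝒦 => Real.log ((condDistrib K Z μ p.1).real {p.2}))
      ((μ.map Z) ⊗ₘ condDistrib K Z μ) := by
  have hm : Measurable fun p : 𝒵 × 𝒦 => Real.log ((condDistrib K Z μ p.1).real {p.2}) :=
    Real.measurable_log.comp measurable_condDistrib_real_singleton
  rw [Measure.integrable_compProd_iff hm.aestronglyMeasurable]
  refine ⟨.of_forall fun z => Integrable.of_finite, ?_⟩
  refine Integrable.of_bound (C := Fintype.card 𝒦) ?_ (.of_forall fun z => ?_)
  · exact (hm.norm.stronglyMeasurable.integral_kernel_prod_right').aestronglyMeasurable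
  · rw [integral_fintype Integrable.of_finite, Real.norm_of_nonneg
      (Finset.sum_nonneg fun k _ => smul_nonneg measureReal_nonneg (norm_nonneg _))]
    refine (Finset.sum_le_card_nsmul _ _ 1 fun k _ => ?_).trans (by simp)
    have h0 : 0 ≤ (condDistrib K Z μ z).real {k} := measureReal_nonneg
    have h1 : (condDistrib K Z μ z).real {k} ≤ 1 := measureReal_le_one
    have := Real.negMulLog_le_one_sub_self h0
    rw [Real.norm_of_nonpos (Real.log_nonpos h0 h1), smul_eq_mul]
    rw [Real.negMulLog] at this
    linarith

/-- Disintegrating the joint law of `(Z, K)` turns the entropy into an expectation over the sample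
space, where it can be compared pointwise with `log R`. -/
theorem integral_log_condDistrib (hK : AEMeasurable K μ) (hZ : AEMeasurable Z μ) :
    Integrable (fun s => Real.log ((condDistrib K Z μ (Z s)).real {K s})) μ ∧
    ∫ s, -Real.log ((condDistrib K Z μ (Z s)).real {K s}) ∂μ
      = ∫ z, ∑ k, Real.negMulLog ((condDistrib K Z μ z).real {k}) ∂(μ.map Z) := by
  have hi := integrable_log_condDistrib (K := K) (Z := Z) (μ := μ)
  have hi' := hi
  rw [compProd_map_condDistrib hK] at hi'
  refine ⟨hi'.comp_aemeasurable (hZ.prodMk hK), ?_⟩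
  rw [← integral_map (hZ.prodMk hK) (f := fun p : 𝒵 × 𝒦 =>
    -Real.log ((condDistrib K Z μ p.1).real {p.2})) hi'.neg.aestronglyMeasurable,
    ← compProd_map_condDistrib hK,
    Measure.integral_compProd (f := fun p : 𝒵 × 𝒦 =>
      -Real.log ((condDistrib K Z μ p.1).real {p.2})) hi.neg]
  refine integral_congr_ae (.of_forall fun z => ?_)
  simp only
  rw [integral_fintype Integrable.of_finite]
  simp [Real.negMulLog]

/-- Lets `log (q R)` be split: a key drawn from the posterior almost surely has positive posterior
mass. -/
theorem ae_condDistrib_pos (hK : AEMeasurable K μ) (hZ : AEMeasurable Z μ) :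
    ∀ᵐ s ∂μ, 0 < (condDistrib K Z μ (Z s)).real {K s} := by
  have hms : MeasurableSet {p : 𝒵 × 𝒦 | 0 < (condDistrib K Z μ p.1).real {p.2}} :=
    measurableSet_lt measurable_const measurable_condDistrib_real_singleton
  have : ∀ᵐ p ∂((μ.map Z) ⊗ₘ condDistrib K Z μ), 0 < (condDistrib K Z μ p.1).real {p.2} := by
    rw [Measure.ae_compProd_iff hms]
    refine .of_forall fun z => ?_
    rw [ae_iff_of_countable]
    intro k hk
    exact ENNReal.toReal_pos hk (measure_ne_top _ _)
  rw [compProd_map_condDistrib hK] at this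
  exact ae_of_ae_map (hZ.prodMk hK) this

/-- Gibbs' inequality: `E[log R]` is at most the conditional entropy of `K` given `Z`, in nats, as
soon as `E[P(K | Z) R] ≤ 1`. -/
theorem integral_log_le_condEntropy (hK : AEMeasurable K μ) (hZ : AEMeasurable Z μ)
    {R : S → ℝ} (hRm : AEMeasurable R μ) (hR : ∀ᵐ s ∂μ, 0 < R s)
    (hlog : Integrable (fun s => Real.log (R s)) μ)
    (hle : ∫⁻ s, ENNReal.ofReal ((condDistrib K Z μ (Z s)).real {K s} * R s) ∂μ ≤ 1) :
    ∫ s, Real.log (R s) ∂μ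
      ≤ ∫ z, ∑ k, Real.negMulLog ((condDistrib K Z μ z).real {k}) ∂(μ.map Z) := by
  obtain ⟨hq, hqe⟩ := integral_log_condDistrib hK hZ
  have hpos := ae_condDistrib_pos hK hZ
  have hqm : AEMeasurable (fun s => (condDistrib K Z μ (Z s)).real {K s} * R s) μ :=
    (measurable_condDistrib_real_singleton.comp_aemeasurable (hZ.prodMk hK)).mul hRm
  have hnn : 0 ≤ᵐ[μ] fun s => (condDistrib K Z μ (Z s)).real {K s} * R s := by
    filter_upwards [hR] with s hs using mul_nonneg measureReal_nonneg hs.le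
  have hqi : Integrable (fun s => (condDistrib K Z μ (Z s)).real {K s} * R s) μ :=
    ⟨hqm.aestronglyMeasurable, (hasFiniteIntegral_iff_ofReal hnn).2 (hle.trans_lt ENNReal.one_lt_top)⟩
  have h1 : ∫ s, (condDistrib K Z μ (Z s)).real {K s} * R s ∂μ ≤ 1 := by
    rw [integral_eq_lintegral_of_nonneg_ae hnn hqm.aestronglyMeasurable]
    exact ENNReal.toReal_le_of_le_ofReal zero_le_one (by simpa using hle)
  have h2 : ∫ s, Real.log (R s) ∂μ ≤ ∫ s, (-Real.log ((condDistrib K Z μ (Z s)).real {K s})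
      + ((condDistrib K Z μ (Z s)).real {K s} * R s - 1)) ∂μ := by
    refine integral_mono_ae hlog (hq.neg.add (hqi.sub (integrable_const 1))) ?_
    filter_upwards [hR, hpos] with s hs hp
    have := Real.log_le_sub_one_of_pos (mul_pos hp hs)
    rw [Real.log_mul hp.ne' hs.ne'] at this
    linarith
  have h3 := integral_add hq.neg (hqi.sub (integrable_const 1))
  have h4 := integral_sub hqi (integrable_const (μ := μ) (1 : ℝ))
  simp only [Pi.neg_apply, Pi.sub_apply] at h3
  rw [h3, h4, hqe, integral_const, probReal_univ, one_smul] at h2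
  linarith

end Gibbs

/-! ### The phase mixture and the inverse posterior. -/

namespace PhaseAuth

/-- The unnormalized density at `x` of the sum of a uniform `M`-PSK phase and a phase noise of
density `f`. -/
noncomputable def phaseMixture (f : ℝ → ℝ) (M : ℕ) (x : ℝ) : ℝ :=
  ∑ κ' : Fin M, f (x - pskPhase κ')

/-- The reciprocal of the posterior probability of the symbol `p.1` given the rotated phase
`φ + υ`, with `υ = p.2`. -/
noncomputable def posteriorInv (f : ℝ → ℝ) {M : ℕ} (p : Fin M × ℝ) : ℝ :=
  phaseMixture f M (pskPhase p.1 + p.2) / f p.2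

theorem logRatio_eq (f : ℝ → ℝ) {M : ℕ} (p : Fin M × ℝ) :
    logRatio f p = Real.log (posteriorInv f p) / Real.log 2 := rfl

/-- Lebesgue measure on `(-π, π]`. -/
noncomputable abbrev phaseVolume : Measure ℝ :=
  volume.restrict (Set.Ioc (-Real.pi) Real.pi)

theorem phaseVolume_eq :
    phaseVolume = volume.restrict (Set.Ioc (-Real.pi) (-Real.pi + 2 * Real.pi)) := by
  rw [phaseVolume]
  congr 2
  ring

theorem toIocMod_eq_add_zsmul (x : ℝ) :
    ∃ n : ℤ, toIocMod Real.two_pi_pos (-Real.pi) x = x + n • (2 * Real.pi) :=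
  ⟨-toIocDiv Real.two_pi_pos (-Real.pi) x, by rw [toIocMod, neg_smul, sub_eq_add_neg]⟩

theorem _root_.Function.Periodic.apply_toIocMod {α : Type*} {g : ℝ → α}
    (hg : Function.Periodic g (2 * Real.pi)) (x : ℝ) :
    g (toIocMod Real.two_pi_pos (-Real.pi) x) = g x := by
  obtain ⟨n, hn⟩ := toIocMod_eq_add_zsmul x
  rw [hn, hg.zsmul n x]

instance (M : ℕ) [NeZero M] : IsProbabilityMeasure (uniformSymbolLaw M) := by
  unfold uniformSymbolLaw
  infer_instance

theorem uniformSymbolLaw_singleton (M : ℕ) [NeZero M] (κ : Fin M) :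
    uniformSymbolLaw M {κ} = (M : ℝ≥0∞)⁻¹ := by
  rw [uniformSymbolLaw, PMF.toMeasure_apply_singleton _ _ (measurableSet_singleton κ)]
  simp

namespace IsPhaseDensity

variable {f : ℝ → ℝ} (hf : IsPhaseDensity f)

include hf

theorem integrable : Integrable f phaseVolume := by
  -- A non-integrable `f` would have Bochner integral `0`, not `1`.
  by_contra h
  exact zero_ne_one ((integral_undef h).symm.trans hf.integral_eq_one)

theorem lintegral_eq_one : ∫⁻ x, ENNReal.ofReal (f x) ∂phaseVolume = 1 := by
  rw [← ofReal_integral_eq_lintegral_ofReal hf.integrable (.of_forall hf.nonneg),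
    hf.integral_eq_one, ENNReal.ofReal_one]

theorem isProbabilityMeasure_phaseLaw : IsProbabilityMeasure (phaseLaw f) :=
  ⟨by rw [phaseLaw, withDensity_apply _ .univ, Measure.restrict_univ, hf.lintegral_eq_one]⟩

theorem measurable_phaseMixture (M : ℕ) : Measurable (phaseMixture f M) :=
  Finset.measurable_fun_sum _ fun _ _ => hf.measurable.comp (measurable_id.sub_const _)

theorem phaseMixture_periodic (M : ℕ) : Function.Periodic (phaseMixture f M) (2 * Real.pi) :=
  fun x => Finset.sum_congr rfl fun κ _ => by
    rw [add_sub_right_comm, hf.periodic]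

theorem phaseMixture_nonneg (M : ℕ) (x : ℝ) : 0 ≤ phaseMixture f M x :=
  Finset.sum_nonneg fun _ _ => hf.nonneg _

theorem le_phaseMixture {M : ℕ} (κ : Fin M) (x : ℝ) : f x ≤ phaseMixture f M (pskPhase κ + x) := by
  have := Finset.single_le_sum (f := fun κ' : Fin M => f (pskPhase κ + x - pskPhase κ'))
    (fun _ _ => hf.nonneg _) (Finset.mem_univ κ)
  simpa [phaseMixture] using this

theorem lintegral_phaseMixture (M : ℕ) :
    ∫⁻ x, ENNReal.ofReal (phaseMixture f M x) ∂phaseVolume = M := by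
  have h : ∀ κ : Fin M, ∫⁻ x, ENNReal.ofReal (f (x - pskPhase κ)) ∂phaseVolume = 1 := fun κ => by
    have hper : Function.Periodic (fun x => ENNReal.ofReal (f x)) (2 * Real.pi) := fun x => by
      simp only [hf.periodic x]
    have := hper.setLIntegral_Ioc_add Real.two_pi_pos (-Real.pi) (-pskPhase κ)
    rw [← phaseVolume_eq, hf.lintegral_eq_one] at this
    simpa only [neg_add_eq_sub] using this
  simp only [phaseMixture]
  simp_rw [ENNReal.ofReal_sum_of_nonneg fun _ _ => hf.nonneg _]
  have hm : ∀ κ : Fin M, Measurable fun x => ENNReal.ofReal (f (x - pskPhase κ)) := fun κ =>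
    (hf.measurable.comp (measurable_id.sub_const _)).ennreal_ofReal
  rw [lintegral_finsetSum _ fun κ _ => hm κ]
  simp [h]

theorem measurable_posteriorInv (M : ℕ) : Measurable (posteriorInv f (M := M)) := by
  have hκ : ∀ κ : Fin M, Measurable fun x => posteriorInv f (κ, x) := fun κ => by
    have := (hf.measurable_phaseMixture M).comp (measurable_const_add (pskPhase κ))
    exact Measurable.fun_div this hf.measurable
  exact measurable_from_prod_countable_right hκ

theorem posteriorInv_nonneg {M : ℕ} (p : Fin M × ℝ) : 0 ≤ posteriorInv f p :=
  div_nonneg (hf.phaseMixture_nonneg _ _) (hf.nonneg _)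

/-- The factor `f x` cancels where it is positive; where it vanishes the left side is `0`, so only
an inequality survives. -/
theorem density_mul_posteriorInv_le {M : ℕ} (κ : Fin M) (x : ℝ) :
    ENNReal.ofReal (f x) * ENNReal.ofReal (posteriorInv f (κ, x))
      ≤ ENNReal.ofReal (phaseMixture f M (pskPhase κ + x)) := by
  rw [← ENNReal.ofReal_mul (hf.nonneg x)]
  refine ENNReal.ofReal_le_ofReal ?_
  rcases (hf.nonneg x).eq_or_lt with h | h
  · rw [← h, zero_mul]
    exact hf.phaseMixture_nonneg _ _
  · rw [posteriorInv, mul_div_cancel₀ _ h.ne']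

theorem ae_phaseLaw_pos : ∀ᵐ x ∂phaseLaw f, 0 < f x := by
  rw [phaseLaw, ae_withDensity_iff hf.measurable.ennreal_ofReal]
  exact .of_forall fun x hx => by simpa using hx

/-- The true symbol contributes `f υ` to the mixture, and `f υ > 0` almost surely. -/
theorem ae_one_le_posteriorInv (M : ℕ) [NeZero M] :
    ∀ᵐ p ∂(uniformSymbolLaw M).prod (phaseLaw f), 1 ≤ posteriorInv f p := by
  have := hf.isProbabilityMeasure_phaseLaw
  filter_upwards [Measure.quasiMeasurePreserving_snd.ae hf.ae_phaseLaw_pos] with p hp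
  exact (one_le_div hp).2 (hf.le_phaseMixture p.1 p.2)

theorem integrable_posteriorInv (M : ℕ) [NeZero M] :
    Integrable (posteriorInv f (M := M)) ((uniformSymbolLaw M).prod (phaseLaw f)) := by
  have := hf.isProbabilityMeasure_phaseLaw
  have hm := hf.measurable_posteriorInv M
  refine ⟨hm.aestronglyMeasurable,
    (hasFiniteIntegral_iff_ofReal (.of_forall hf.posteriorInv_nonneg)).2 ?_⟩
  rw [lintegral_prod _ hm.ennreal_ofReal.aemeasurable]
  refine (lintegral_mono (g := fun _ => (M : ℝ≥0∞)) fun κ => ?_).trans_lt (by simp)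
  have hper : Function.Periodic (fun x => ENNReal.ofReal (phaseMixture f M x)) (2 * Real.pi) :=
    fun x => by simp only [hf.phaseMixture_periodic M x]
  have h := hper.setLIntegral_Ioc_add Real.two_pi_pos (-Real.pi) (pskPhase κ)
  rw [← phaseVolume_eq, hf.lintegral_phaseMixture] at h
  have hmκ : Measurable fun x => ENNReal.ofReal (posteriorInv f (κ, x)) :=
    (hm.comp measurable_prodMk_left).ennreal_ofReal
  rw [← h, phaseLaw, lintegral_withDensity_eq_lintegral_mul _ hf.measurable.ennreal_ofReal hmκ]
  exact lintegral_mono fun x => hf.density_mul_posteriorInv_le κ x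

/-- Almost surely `0 ≤ log R ≤ R`, and `R` has mean at most `M`. -/
theorem integrable_log_posteriorInv (M : ℕ) [NeZero M] :
    Integrable (fun p => Real.log (posteriorInv f (M := M) p))
      ((uniformSymbolLaw M).prod (phaseLaw f)) := by
  refine (hf.integrable_posteriorInv M).mono'
    (Real.measurable_log.comp (hf.measurable_posteriorInv M)).aestronglyMeasurable ?_
  filter_upwards [hf.ae_one_le_posteriorInv M] with p hp
  rw [Real.norm_of_nonneg (Real.log_nonneg hp)]
  exact Real.log_le_self (zero_le_one.trans hp)

theorem lintegral_pi_phaseLaw_le {L M : ℕ} (κ : Fin L → Fin M) {G : (Fin L → ℝ) → ℝ≥0∞}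
    (hG : Measurable G)
    (hper : ∀ x, G (fun i => toIocMod Real.two_pi_pos (-Real.pi) (x i)) = G x) :
    ∫⁻ υ, G (fun i => pskPhase (κ i) + υ i) * ∏ i, ENNReal.ofReal (posteriorInv f (κ i, υ i))
        ∂Measure.pi (fun _ => phaseLaw f)
      ≤ ∫⁻ x, G x * ∏ i, ENNReal.ofReal (phaseMixture f M (x i))
        ∂Measure.pi (fun _ => phaseVolume) := by
  have := hf.isProbabilityMeasure_phaseLaw
  have hfm := hf.measurable.ennreal_ofReal
  have : SigmaFinite (phaseVolume.withDensity fun x => ENNReal.ofReal (f x)) :=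
    inferInstanceAs (SigmaFinite (phaseLaw f))
  have hGm : Measurable fun υ : Fin L → ℝ => G fun i => pskPhase (κ i) + υ i := by fun_prop
  have hm := (hf.measurable_posteriorInv M).ennreal_ofReal
  have hF : Measurable fun x : Fin L → ℝ =>
      G x * ∏ i, ENNReal.ofReal (phaseMixture f M (x i)) :=
    hG.mul (Finset.measurable_fun_prod _ fun i _ =>
      ((hf.measurable_phaseMixture M).comp (measurable_pi_apply i)).ennreal_ofReal)
  have htr := lintegral_pi_Ioc_add Real.two_pi_pos (-Real.pi) (fun i => pskPhase (κ i)) hF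
    fun x => by simp only [hper, (hf.phaseMixture_periodic M).apply_toIocMod]
  rw [← phaseVolume_eq] at htr
  rw [← htr]
  have hlaw := pi_withDensity (fun _ : Fin L => phaseVolume) (fun _ x => ENNReal.ofReal (f x))
    fun _ => hfm
  change ∫⁻ υ, _ ∂Measure.pi (fun _ => phaseVolume.withDensity fun x => ENNReal.ofReal (f x)) ≤ _
  rw [hlaw, lintegral_withDensity_eq_lintegral_mul]
  · refine lintegral_mono fun υ => ?_
    simp only [Pi.mul_apply]
    rw [mul_left_comm, ← Finset.prod_mul_distrib]
    gcongr with i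
    exact hf.density_mul_posteriorInv_le (κ i) (υ i)
  · exact Finset.measurable_fun_prod _ fun i _ => hfm.comp (measurable_pi_apply i)
  · exact hGm.mul (Finset.measurable_fun_prod _ fun i _ =>
      hm.comp (measurable_const.prodMk (measurable_pi_apply i)))

/-- A conditional law `G` of the key given the rotated phases integrates against the inverse
posterior to at most `1`. -/
theorem lintegral_mul_posteriorInv_le_one {L M : ℕ} [NeZero M]
    {G : (Fin L → Fin M) → (Fin L → ℝ) → ℝ≥0∞} (hG : ∀ κ, Measurable (G κ))
    (hper : ∀ κ x, G κ (fun i => toIocMod Real.two_pi_pos (-Real.pi) (x i)) = G κ x)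
    (hsum : ∀ x, ∑ κ, G κ x ≤ 1) :
    ∫⁻ p, G p.1 (fun i => pskPhase (p.1 i) + p.2 i)
        * ∏ i, ENNReal.ofReal (posteriorInv f (p.1 i, p.2 i))
        ∂(Measure.pi fun _ : Fin L => uniformSymbolLaw M).prod
          (Measure.pi fun _ : Fin L => phaseLaw f) ≤ 1 := by
  have := hf.isProbabilityMeasure_phaseLaw
  have hm := (hf.measurable_posteriorInv M).ennreal_ofReal
  have hmm : Measurable fun p : (Fin L → Fin M) × (Fin L → ℝ) =>
      G p.1 (fun i => pskPhase (p.1 i) + p.2 i)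
        * ∏ i, ENNReal.ofReal (posteriorInv f (p.1 i, p.2 i)) := by
    refine measurable_from_prod_countable_right fun κ => ?_
    refine Measurable.mul ?_ (Finset.measurable_fun_prod _ fun i _ =>
      hm.comp (measurable_const.prodMk (measurable_pi_apply i)))
    exact (hG κ).comp (by fun_prop)
  have hF : Measurable fun x : Fin L → ℝ => ∏ i, ENNReal.ofReal (phaseMixture f M (x i)) :=
    Finset.measurable_fun_prod _ fun i _ =>
      ((hf.measurable_phaseMixture M).comp (measurable_pi_apply i)).ennreal_ofReal
  have hM : (M : ℝ≥0∞) ≠ 0 := by exact_mod_cast NeZero.ne M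
  rw [lintegral_prod _ hmm.aemeasurable, lintegral_fintype]
  simp_rw [Measure.pi_singleton, uniformSymbolLaw_singleton, Finset.prod_const]
  rw [← Finset.sum_mul]
  calc _ ≤ (∑ κ, ∫⁻ x, G κ x * ∏ i, ENNReal.ofReal (phaseMixture f M (x i))
        ∂Measure.pi (fun _ => phaseVolume)) * (M : ℝ≥0∞)⁻¹ ^ L := by
        rw [Finset.card_univ, Fintype.card_fin]
        refine mul_le_mul_left (Finset.sum_le_sum fun κ _ => ?_) _
        exact hf.lintegral_pi_phaseLaw_le κ (hG κ) (hper κ)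
    _ ≤ (M : ℝ≥0∞) ^ L * (M : ℝ≥0∞)⁻¹ ^ L := by
        gcongr
        have hGF : ∀ κ, Measurable fun x =>
            G κ x * ∏ i, ENNReal.ofReal (phaseMixture f M (x i)) := fun κ => (hG κ).mul hF
        -- The weight no longer depends on `κ`, so the sum over keys can act on `G` alone.
        rw [← lintegral_finsetSum _ fun κ _ => hGF κ]
        calc _ ≤ ∫⁻ x : Fin L → ℝ, ∏ i, ENNReal.ofReal (phaseMixture f M (x i))
              ∂Measure.pi (fun _ => phaseVolume) := by
              refine lintegral_mono fun x => ?_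
              simp only
              rw [← Finset.sum_mul]
              exact mul_le_of_le_one_left' (hsum x)
          _ = (M : ℝ≥0∞) ^ L := by
              rw [lintegral_pi_fin_prod _ (fun _ x => ENNReal.ofReal (phaseMixture f M x))
                fun _ => (hf.measurable_phaseMixture M).ennreal_ofReal]
              simp [hf.lintegral_phaseMixture]
    _ = 1 := by
        rw [← mul_pow, ENNReal.mul_inv_cancel hM (ENNReal.natCast_ne_top M), one_pow]

end IsPhaseDensity

/-! ### Eve's observation through the rotated phases. -/

/-- Eve's observation as a function of the rotated phases `x k = φ_k + υ_k`. -/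
noncomputable def phaseObservation {L : ℕ} (h : Fin L → ℂ) (thetaHat : Fin L → ℝ) (lam : ℝ)
    (x : Fin L → ℝ) : Fin L → ℂ :=
  fun k => h k * Complex.exp (Complex.I * (lam : ℂ))
    * Complex.exp (Complex.I * ((x k - thetaHat k : ℝ) : ℂ))

theorem eveObservation_eq {L M : ℕ} (h : Fin L → ℂ) (thetaHat : Fin L → ℝ)
    (κ : Fin L → Fin M) (υ : Fin L → ℝ) (lam : ℝ) :
    eveObservation h thetaHat κ υ lam
      = phaseObservation h thetaHat lam fun i => pskPhase (κ i) + υ i := by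
  funext k
  simp only [eveObservation, phaseObservation, bobResponse]
  congr 4
  ring

theorem measurable_phaseObservation {L : ℕ} (h : Fin L → ℂ) (thetaHat : Fin L → ℝ) :
    Measurable fun p : ℝ × (Fin L → ℝ) => phaseObservation h thetaHat p.1 p.2 := by
  unfold phaseObservation
  fun_prop

theorem phaseObservation_toIocMod {L : ℕ} (h : Fin L → ℂ) (thetaHat : Fin L → ℝ) (lam : ℝ)
    (x : Fin L → ℝ) :
    phaseObservation h thetaHat lam (fun i => toIocMod Real.two_pi_pos (-Real.pi) (x i))
      = phaseObservation h thetaHat lam x := by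
  funext k
  have hper : Function.Periodic
      (fun y : ℝ => Complex.exp (Complex.I * ((y - thetaHat k : ℝ) : ℂ))) (2 * Real.pi) := by
    intro y
    have : Complex.I * ((y + 2 * Real.pi - thetaHat k : ℝ) : ℂ)
        = Complex.I * ((y - thetaHat k : ℝ) : ℂ) + 2 * Real.pi * Complex.I := by
      push_cast
      ring
    simp only [this, Complex.exp_periodic _]
  simp only [phaseObservation]
  rw [hper.apply_toIocMod (x k)]

theorem measurable_eveObservation {L M : ℕ} (h : Fin L → ℂ) (thetaHat : Fin L → ℝ) :
    Measurable fun p : ((Fin L → Fin M) × (Fin L → ℝ)) × ℝ =>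
      eveObservation h thetaHat p.1.1 p.1.2 p.2 := by
  simp_rw [eveObservation_eq]
  have hp : Measurable (pskPhase (M := M)) := measurable_of_countable _
  have hx : Measurable fun p : ((Fin L → Fin M) × (Fin L → ℝ)) × ℝ =>
      fun i => pskPhase (p.1.1 i) + p.1.2 i := measurable_pi_lambda _ fun i =>
    (hp.comp ((measurable_pi_apply i).comp (measurable_fst.comp measurable_fst))).add
      ((measurable_pi_apply i).comp (measurable_snd.comp measurable_fst))
  have := (measurable_phaseObservation h thetaHat).comp (measurable_snd.prodMk hx)

  exact this

instance : IsProbabilityMeasure uniformPhaseLaw := by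
  refine cond_isProbabilityMeasure_of_finite ?_ ?_
  · simp [Real.pi_pos]
  · simp

end PhaseAuth

/-! ### The entropy bound. -/

open PhaseAuth in
theorem lemma2 {S : Type*} [MeasurableSpace S] (μ : Measure S) [IsProbabilityMeasure μ]
    (L M : ℕ) [NeZero M]
    -- density of the artificial phase noise
    (f : ℝ → ℝ) (hf : PhaseAuth.IsPhaseDensity f)
    -- static subchannels: Eve's gains and Bob's channel-phase estimates are fixed
    (h : Fin L → ℂ) (thetaHat : Fin L → ℝ)
    -- key symbols, artificial phase noise, common phase rotation
    (κ : Fin L → S → Fin M) (υ : Fin L → S → ℝ) (lam : S → ℝ)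
    (hκ : ∀ k, HasLaw (κ k) (PhaseAuth.uniformSymbolLaw M) μ)
    (hυ : ∀ k, HasLaw (υ k) (PhaseAuth.phaseLaw f) μ)
    (hlam : HasLaw lam PhaseAuth.uniformPhaseLaw μ)
    (hκ_indep : iIndepFun κ μ) (hυ_indep : iIndepFun υ μ)
    (hκυ : IndepFun (fun s k => κ k s) (fun s k => υ k s) μ)
    (hκυlam : IndepFun (fun s => ((fun k => κ k s), (fun k => υ k s))) lam μ) :
    Integrable (PhaseAuth.logRatio f (M := M))
        ((PhaseAuth.uniformSymbolLaw M).prod (PhaseAuth.phaseLaw f)) ∧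
      (L : ℝ) * ∫ p, PhaseAuth.logRatio f p
          ∂((PhaseAuth.uniformSymbolLaw M).prod (PhaseAuth.phaseLaw f)) ≤
        PhaseAuth.equivocation (fun s k => κ k s)
          (fun s => PhaseAuth.eveObservation h thetaHat
            (fun k => κ k s) (fun k => υ k s) (lam s)) μ := by
  have hprob := hf.isProbabilityMeasure_phaseLaw
  have hlog := hf.integrable_log_posteriorInv M
  refine ⟨hlog.div_const _, ?_⟩
  have hKU := hκυ.hasLaw_prod (hκ_indep.hasLaw_pi hκ) (hυ_indep.hasLaw_pi hυ)
  have hKUlam := hκυlam.hasLaw_prod hKU hlam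
  have hpair : ∀ i, HasLaw (fun s => (κ i s, υ i s))
      ((uniformSymbolLaw M).prod (phaseLaw f)) μ := fun i =>
    (hκυ.comp (measurable_pi_apply i) (measurable_pi_apply i)).hasLaw_prod (hκ i) (hυ i)
  have hK : AEMeasurable (fun s k => κ k s) μ := (hκ_indep.hasLaw_pi hκ).aemeasurable
  have hZ : AEMeasurable (fun s => eveObservation h thetaHat
      (fun k => κ k s) (fun k => υ k s) (lam s)) μ := by
    have := (measurable_eveObservation h thetaHat).comp_aemeasurable hKUlam.aemeasurable
    exact this
  have hpos : ∀ᵐ s ∂μ, ∀ i, 0 < posteriorInv f (κ i s, υ i s) := by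
    rw [ae_all_iff]
    intro i
    have := hf.ae_one_le_posteriorInv M
    rw [← (hpair i).map_eq] at this
    filter_upwards [ae_of_ae_map (hpair i).aemeasurable this] with s hs
    exact zero_lt_one.trans_le hs
  have hlogi : ∀ i, Integrable (fun s => Real.log (posteriorInv f (κ i s, υ i s))) μ := fun i => by
    have := hlog
    rw [← (hpair i).map_eq] at this
    exact this.comp_aemeasurable (hpair i).aemeasurable
  have hlogprod : (fun s => Real.log (∏ i, posteriorInv f (κ i s, υ i s)))
      =ᵐ[μ] fun s => ∑ i, Real.log (posteriorInv f (κ i s, υ i s)) := by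
    filter_upwards [hpos] with s hs
    exact Real.log_prod fun i _ => (hs i).ne'
  have hgibbs := integral_log_le_condEntropy hK hZ
    (R := fun s => ∏ i, posteriorInv f (κ i s, υ i s))
    (Finset.aemeasurable_fun_prod _ fun i _ =>
      (hf.measurable_posteriorInv M).comp_aemeasurable (hpair i).aemeasurable)
    (by filter_upwards [hpos] with s hs using Finset.prod_pos fun i _ => hs i)
    ((integrable_finsetSum _ fun i _ => hlogi i).congr hlogprod.symm)
    ?_
  · have hsum : ∫ s, Real.log (∏ i, posteriorInv f (κ i s, υ i s)) ∂μ
        = L * ∫ p, Real.log (posteriorInv f p) ∂((uniformSymbolLaw M).prod (phaseLaw f)) := by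
      have hi : ∀ i, ∫ s, Real.log (posteriorInv f (κ i s, υ i s)) ∂μ
          = ∫ p, Real.log (posteriorInv f p) ∂((uniformSymbolLaw M).prod (phaseLaw f)) :=
        fun i => (hpair i).integral_comp hlog.aestronglyMeasurable
      rw [integral_congr_ae hlogprod, integral_finsetSum _ fun i _ => hlogi i]
      simp [hi]
    rw [hsum] at hgibbs
    simp_rw [logRatio_eq, equivocation, integral_div]
    rw [← mul_div_assoc]
    gcongr
  · set q := condDistrib (fun s k => κ k s) (fun s => eveObservation h thetaHat
      (fun k => κ k s) (fun k => υ k s) (lam s)) μ with hq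
    have hqm : Measurable fun p : (Fin L → ℂ) × (Fin L → Fin M) => (q p.1).real {p.2} :=
      measurable_condDistrib_real_singleton
    have hΦ : Measurable fun p : ((Fin L → Fin M) × (Fin L → ℝ)) × ℝ =>
        ENNReal.ofReal ((q (eveObservation h thetaHat p.1.1 p.1.2 p.2)).real {p.1.1}
          * ∏ i, posteriorInv f (p.1.1 i, p.1.2 i)) := by
      refine (Measurable.mul ?_ ?_).ennreal_ofReal
      · have := hqm.comp ((measurable_eveObservation h thetaHat).prodMk
          (measurable_fst.comp measurable_fst))
        exact this
      · exact Finset.measurable_fun_prod _ fun i _ =>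
          (hf.measurable_posteriorInv M).comp (by fun_prop)
    rw [hKUlam.lintegral_comp hΦ.aemeasurable, lintegral_prod_symm _ hΦ.aemeasurable]
    -- The bound holds for each fixed rotation `t`, although `q` conditions on `Z` only.
    refine (lintegral_mono (g := fun _ => 1) fun t => ?_).trans (by simp)
    have hsing : ∀ z k, ENNReal.ofReal ((q z).real {k}) = q z {k} := fun z k =>
      ENNReal.ofReal_toReal (measure_ne_top _ _)
    simp only
    simp_rw [eveObservation_eq, ENNReal.ofReal_mul measureReal_nonneg, hsing,
      ENNReal.ofReal_prod_of_nonneg fun i _ => hf.posteriorInv_nonneg _]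
    refine hf.lintegral_mul_posteriorInv_le_one
      (G := fun k x => q (phaseObservation h thetaHat t x) {k}) (fun k => ?_) (fun k x => ?_)
      fun x => ?_
    · have := (q.measurable_coe (measurableSet_singleton k)).comp
        ((measurable_phaseObservation h thetaHat).comp (measurable_prodMk_left (x := t)))
      exact this
    · simp only [phaseObservation_toIocMod]
    · rw [sum_measure_singleton]
      exact prob_le_one
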